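/- For integers $r\ge 1$ and $n\ge 0$, an $r$-graph $G$ on a finite vertex set $V$ is given by a set $E(G)$ of $r$-element subsets of $V$. For $x\in\mathbb R^V$ put $\lambda(G,x)=\sum_{e\in E(G)}\prod_{i\in e}x_i$. For $V\ne\emptyset$ the Lagrangian of $G$ is $$\lambda(G)=\max\Big\{\lambda(G,x): x_i\ge 0 \text{ for all } i\in V,\ \sum_{i\in V}x_i=1\Big\}.$$ Let $[n]^{(r)}$ denote the complete $r$-graph on $n$ vertices. In the colex ordering of the $r$-element sets of positive integers, $A$ precedes $B\ne A$ if $\max(A\triangle B)\in B$; let $C_{r,m}$ denote the $r$-graph whose edges are the first $m$ sets in this ordering. **Corollary 1.7.** Let $r\ge 4$, $t\ge 2$ and $m\ge 0$ be integers satisfying $$\binom{t-1}{r}\le m\le\binom{t-1}{r}+\binom{t-2}{r-1}-\Big[(2r-6)\,2^{r-1}+2^{r-3}+(r-4)(2r-7)-1\Big]\left(\binom{t-2}{r-2}-1\right).$$ Then every $r$-graph $G$ with $t$ vertices and $m$ edges satisfies $\lambda(G)\le\lambda([t-1]^{(r)})$. Moreover, if an $r$-graph with $t$ vertices and $m$ edges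 exists, then the $m$ edges of $C_{r,m}$ are all contained in $\{1,\dots,t\}$, and $C_{r,m}$, regarded as an $r$-graph on the vertex set $\{1,\dots,t\}$, satisfies $\lambda(G)\le\lambda(C_{r,m})$ for every such $G$; that is, $C_{r,m}$ has the largest Lagrangian among all $r$-graphs with $t$ vertices and $m$ edges. -/

import Mathlib

namespace HypergraphLagrangian

/-- An `r`-uniform hypergraph (`r`-graph) with vertex set `V`: a set of edges, each of which is
an `r`-element set of vertices. -/
structure RGraph (V : Type*) (r : ℕ) where
  /-- The edge set. -/
  edges : Finset (Finset V)
  /-- Every edge has exactly `r` vertices. -/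
  card_eq : ∀ e ∈ edges, e.card = r

/-- `λ(G, x)`, the sum over all edges of the product of the weights of the vertices of the edge. -/
def RGraph.weightPoly {V : Type*} {r : ℕ} (G : RGraph V r) (x : V → ℝ) : ℝ :=
  ∑ e ∈ G.edges, ∏ i ∈ e, x i

/-- The Lagrangian `λ(G)`, the maximum of `λ(G, x)` over the standard simplex of weightings.
It is written as a supremum; `RGraph.isGreatest_lagrangian` shows that it is attained. -/
noncomputable def RGraph.lagrangian {V : Type*} [Fintype V] {r : ℕ} (G : RGraph V r) : ℝ :=
  sSup (G.weightPoly '' stdSimplex ℝ V)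

/-- On a nonempty vertex set the Lagrangian is a maximum. -/
theorem RGraph.isGreatest_lagrangian {V : Type*} [Fintype V] [Nonempty V] {r : ℕ}
    (G : RGraph V r) : IsGreatest (G.weightPoly '' stdSimplex ℝ V) G.lagrangian := by
  classical
  have hc : Continuous G.weightPoly := by
    unfold RGraph.weightPoly
    fun_prop
  have hne : (stdSimplex ℝ V).Nonempty :=
    ⟨_, single_mem_stdSimplex ℝ (Classical.arbitrary V)⟩
  exact ((isCompact_stdSimplex ℝ V).image hc).isGreatest_sSup (hne.image _)

/-- `[n]^{(r)}`, the complete `r`-graph on `n` vertices (the vertex set is `Fin n`). -/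
def completeRGraph (n r : ℕ) : RGraph (Fin n) r where
  edges := Finset.univ.powersetCard r
  card_eq := fun _ he => (Finset.mem_powersetCard.mp he).2

/-- The first `m` sets in the colex ordering of the `r`-element subsets of the natural numbers:
those `r`-sets that have fewer than `m` predecessors among all `r`-sets. (The natural numbers
start at `0` here, which is only a shift of the labels.) In Mathlib's order on
`Colex (Finset ℕ)`, `A` is below `B ≠ A` when the largest element of the symmetric difference
lies in `B`. -/
def firstColex (r m : ℕ) : Set (Finset ℕ) :=
  {A | A.card = r ∧ {B : Finset ℕ | B.card = r ∧ toColex B < toColex A}.ncard < m}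

/-- Every finite set has only finitely many colex predecessors, so the count in `firstColex` is a
genuine one. -/
theorem finite_colex_lt (A : Finset ℕ) : {B : Finset ℕ | toColex B < toColex A}.Finite := by
  refine (Finset.range (A.sup id + 1)).powerset.finite_toSet.subset fun B hB => ?_
  have h : ∀ b ∈ B, b < A.sup id + 1 :=
    Finset.Colex.forall_lt_mono (le_of_lt hB)
      fun a ha => Nat.lt_succ_of_le (Finset.le_sup (f := id) ha)
  exact Finset.mem_coe.mpr (Finset.mem_powerset.mpr fun b hb => Finset.mem_range.mpr (h b hb))

open Classical in
/-- The `r`-graph `C_{r,m}`, whose edges are the first `m` sets in the colex ordering of the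
`r`-element sets of natural numbers, on the `t` vertices `0, …, t - 1`. (This keeps just those of
the `m` sets that lie inside the vertex set; they all do as soon as `m ≤ t.choose r`.) -/
noncomputable def colexRGraph (t r m : ℕ) : RGraph (Fin t) r where
  edges := Finset.univ.filter fun A : Finset (Fin t) => A.map Fin.valEmbedding ∈ firstColex r m
  card_eq := fun A hA => by
    have h : (A.map Fin.valEmbedding).card = r := (Finset.mem_filter.mp hA).2.1
    simpa using h

end HypergraphLagrangian

/-! Put `n = t - 1` and `r = k + 2`. The colex graph contains every `r`-subset of the first `n`
vertices as soon as `n.choose r ≤ m`, so both Lagrangian bounds reduce to `λ(G) ≤ λ([n]^(r))`.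

Suppose this fails and let `x` be optimal for `G`. The Lagrange condition, Maclaurin's inequality
and Bernoulli's inequality force every weight to be at most `v = 1 / (n - k - 1)`
(`RGraph.weight_le_of_lagrangian_lt`). The `n + 1` weights sum to 1, so they are nearly equal: at
most `2k + 4` vertices are light, that is, of weight at most `v / 2` (`card_light_le`).

Let `p`, `q` carry the two smallest weights. A missing edge with at most two light vertices weighs
at least `x p * x q * (v / 2) ^ k` (`mul_pow_le_prod`). Few `r`-sets have three light vertices, so
at least `2 ^ k * (n - 1).choose k` missing edges are of the first kind
(`two_pow_mul_choose_add_le`). Together they outweigh all `r`-sets through both `p` and `q`. But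
deleting those sets from the complete graph already brings its weight down to at most `λ([n]^(r))`,
because the weight of `p` can then be moved to `q` (`elemSymm_sub_le_lagrangian`). This is a
contradiction. -/

namespace HypergraphLagrangian

/-! ### Elementary symmetric polynomials and Maclaurin's inequality -/

/-- The elementary symmetric polynomial of degree `k` in the weights of the elements of `s`. -/
def elemSymm {ι : Type*} (s : Finset ι) (k : ℕ) (x : ι → ℝ) : ℝ :=
  ∑ e ∈ s.powersetCard k, ∏ i ∈ e, x i

section ElemSymm

variable {ι : Type*} {s : Finset ι} {k : ℕ} {x : ι → ℝ}

theorem elemSymm_zero : elemSymm s 0 x = 1 := by simp [elemSymm]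

theorem elemSymm_nonneg (hx : ∀ i ∈ s, 0 ≤ x i) : 0 ≤ elemSymm s k x :=
  Finset.sum_nonneg fun _ he => Finset.prod_nonneg fun i hi =>
    hx i ((Finset.mem_powersetCard.mp he).1 hi)

theorem elemSymm_map {κ : Type*} (f : κ ↪ ι) (s : Finset κ) (k : ℕ) (x : ι → ℝ) :
    elemSymm (s.map f) k x = elemSymm s k (x ∘ f) := by
  simp [elemSymm, Finset.powersetCard_map]

theorem elemSymm_congr {y : ι → ℝ} (h : ∀ i ∈ s, x i = y i) :
    elemSymm s k x = elemSymm s k y :=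
  Finset.sum_congr rfl fun _ he => Finset.prod_congr rfl fun i hi =>
    h i ((Finset.mem_powersetCard.mp he).1 hi)

theorem elemSymm_le_choose_mul_pow {c : ℝ} (h0 : ∀ i ∈ s, 0 ≤ x i) (hc : ∀ i ∈ s, x i ≤ c) :
    elemSymm s k x ≤ s.card.choose k * c ^ k := by
  calc elemSymm s k x ≤ ∑ _e ∈ s.powersetCard k, c ^ k := by
        refine Finset.sum_le_sum fun e he => ?_
        obtain ⟨hs, hk⟩ := Finset.mem_powersetCard.mp he
        rw [← hk]
        exact (Finset.prod_le_prod (fun i hi => h0 i (hs hi)) fun i hi => hc i (hs hi)).trans_eq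
          (Finset.prod_const c)
    _ = s.card.choose k * c ^ k := by simp

variable [DecidableEq ι]

theorem elemSymm_insert {a : ι} (ha : a ∉ s) :
    elemSymm (insert a s) (k + 1) x = elemSymm s (k + 1) x + x a * elemSymm s k x := by
  have hn : ∀ e ∈ s.powersetCard k, a ∉ e := fun e he h =>
    ha ((Finset.mem_powersetCard.mp he).1 h)
  unfold elemSymm
  rw [Finset.powersetCard_succ_insert ha, Finset.sum_union, Finset.sum_image, Finset.mul_sum]
  · exact congrArg _ (Finset.sum_congr rfl fun e he => Finset.prod_insert (hn e he))
  · intro e he f hf h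
    rw [← Finset.erase_insert (hn e he), h, Finset.erase_insert (hn f hf)]
  · rw [Finset.disjoint_left]
    intro e he h
    obtain ⟨f, -, rfl⟩ := Finset.mem_image.mp h
    exact ha ((Finset.mem_powersetCard.mp he).1 (Finset.mem_insert_self a f))

theorem elemSymm_eq_erase {a : ι} (ha : a ∈ s) :
    elemSymm s (k + 1) x = elemSymm (s.erase a) (k + 1) x + x a * elemSymm (s.erase a) k x := by
  conv_lhs => rw [← Finset.insert_erase ha]
  exact elemSymm_insert (Finset.notMem_erase a s)

theorem elemSymm_erase_of_eq_zero {a : ι} (ha : a ∈ s) (h : x a = 0) :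
    elemSymm s k x = elemSymm (s.erase a) k x := by
  cases k with
  | zero => simp [elemSymm_zero]
  | succ k => rw [elemSymm_eq_erase ha, h]; ring

/-- Double counting: a `k`-subset of `s` survives the erasure of exactly the `s.card - k` elements
outside it. -/
theorem sum_elemSymm_erase (s : Finset ι) (k : ℕ) (x : ι → ℝ) :
    ∑ i ∈ s, elemSymm (s.erase i) k x = ((s.card : ℝ) - k) * elemSymm s k x := by
  unfold elemSymm
  rw [Finset.sum_comm' (t' := s.powersetCard k) (s' := fun e => s \ e), Finset.mul_sum]
  · refine Finset.sum_congr rfl fun e he => ?_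
    obtain ⟨hs, hk⟩ := Finset.mem_powersetCard.mp he
    rw [Finset.sum_const, nsmul_eq_mul, Finset.card_sdiff_of_subset hs,
      Nat.cast_sub (Finset.card_le_card hs), hk]
  · intro i e
    simp only [Finset.mem_powersetCard, Finset.mem_sdiff, Finset.subset_erase]
    tauto

theorem sum_mul_elemSymm_erase (s : Finset ι) (k : ℕ) (x : ι → ℝ) :
    ∑ i ∈ s, x i * elemSymm (s.erase i) k x = ((k : ℝ) + 1) * elemSymm s (k + 1) x := by
  have h : ∀ i ∈ s, x i * elemSymm (s.erase i) k x
      = elemSymm s (k + 1) x - elemSymm (s.erase i) (k + 1) x := fun i hi => by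
    rw [elemSymm_eq_erase hi]; ring
  rw [Finset.sum_congr rfl h, Finset.sum_sub_distrib, sum_elemSymm_erase]
  simp only [Finset.sum_const, nsmul_eq_mul]
  push_cast
  ring

theorem elemSymm_erase_anti (hx : ∀ i ∈ s, 0 ≤ x i) {i j : ι} (hi : i ∈ s) (hj : j ∈ s)
    (hij : x i ≤ x j) : elemSymm (s.erase j) k x ≤ elemSymm (s.erase i) k x := by
  rcases eq_or_ne i j with rfl | hne
  · rfl
  cases k with
  | zero => simp [elemSymm_zero]
  | succ k =>
    rw [elemSymm_eq_erase (Finset.mem_erase.mpr ⟨hne, hi⟩),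
      elemSymm_eq_erase (a := j) (s := s.erase i) (Finset.mem_erase.mpr ⟨hne.symm, hj⟩),
      Finset.erase_right_comm]
    have : 0 ≤ elemSymm ((s.erase i).erase j) k x := elemSymm_nonneg fun l hl =>
      hx l (Finset.mem_of_mem_erase (Finset.mem_of_mem_erase hl))
    gcongr

/-- Chebyshev's sum inequality: by `elemSymm_erase_anti`, a larger `x i` goes with a smaller
polynomial in the remaining weights. This is the inductive step of Maclaurin's inequality. -/
theorem card_mul_elemSymm_succ_le (hx : ∀ i ∈ s, 0 ≤ x i) :
    (s.card : ℝ) * (((k : ℝ) + 1) * elemSymm s (k + 1) x)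
      ≤ (∑ i ∈ s, x i) * (((s.card : ℝ) - k) * elemSymm s k x) := by
  rw [← sum_mul_elemSymm_erase, ← sum_elemSymm_erase]
  refine AntivaryOn.card_mul_sum_le_sum_mul_sum fun i hi j hj h => ?_
  by_contra hc
  exact absurd h (not_lt.mpr (elemSymm_erase_anti hx hi hj (not_le.mp hc).le))

/-- Maclaurin's inequality between the first and the `k`-th elementary symmetric mean. -/
theorem elemSymm_le_maclaurin (hx : ∀ i ∈ s, 0 ≤ x i) (k : ℕ) (hk : k ≤ s.card) :
    elemSymm s k x ≤ s.card.choose k * ((∑ i ∈ s, x i) / s.card) ^ k := by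
  induction k with
  | zero => simp [elemSymm_zero]
  | succ k ih =>
    have hn : (0 : ℝ) < s.card := by exact_mod_cast (Nat.succ_pos k).trans_le hk
    have hsum : 0 ≤ ∑ i ∈ s, x i := Finset.sum_nonneg hx
    have hsub : (0 : ℝ) ≤ (s.card : ℝ) - k := by
      rw [sub_nonneg]; exact_mod_cast (Nat.le_succ k).trans hk
    have h1 := card_mul_elemSymm_succ_le (k := k) hx
    have h2 := ih ((Nat.le_succ k).trans hk)
    have hch : (s.card.choose (k + 1) : ℝ) * (k + 1) = s.card.choose k * ((s.card : ℝ) - k) := by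
      have := Nat.choose_succ_right_eq s.card k
      rw [← Nat.cast_sub ((Nat.le_succ k).trans hk)]
      exact_mod_cast this
    have hk1 : (0 : ℝ) < (k : ℝ) + 1 := by positivity
    refine le_of_mul_le_mul_left ?_ (mul_pos hn hk1)
    calc (s.card : ℝ) * ((k : ℝ) + 1) * elemSymm s (k + 1) x
        ≤ (∑ i ∈ s, x i) * (((s.card : ℝ) - k) * elemSymm s k x) := by rw [mul_assoc]; exact h1
      _ ≤ (∑ i ∈ s, x i) * (((s.card : ℝ) - k) *
            (s.card.choose k * ((∑ i ∈ s, x i) / s.card) ^ k)) := by gcongr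
      _ = (∑ i ∈ s, x i) * ((s.card.choose (k + 1) * (k + 1))
            * ((∑ i ∈ s, x i) / s.card) ^ k) := by rw [hch]; ring
      _ = _ := by rw [pow_succ]; field_simp

end ElemSymm

/-! ### Homogeneity and partial derivatives of the weight polynomial -/

section WeightPoly

variable {V : Type*} {r : ℕ}

theorem RGraph.weightPoly_smul (G : RGraph V r) (c : ℝ) (x : V → ℝ) :
    G.weightPoly (fun i => c * x i) = c ^ r * G.weightPoly x := by
  unfold RGraph.weightPoly
  rw [Finset.mul_sum]
  refine Finset.sum_congr rfl fun e he => ?_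
  rw [Finset.prod_mul_distrib, Finset.prod_const, G.card_eq e he]

variable [DecidableEq V]

/-- The partial derivative of `λ(G, x)` with respect to the weight of the vertex `i`. -/
def RGraph.linkWeight (G : RGraph V r) (i : V) (x : V → ℝ) : ℝ :=
  ∑ e ∈ G.edges with i ∈ e, ∏ j ∈ e.erase i, x j

theorem RGraph.weightPoly_update (G : RGraph V r) (i : V) (w : ℝ) (x : V → ℝ) :
    G.weightPoly (Function.update x i w) = G.weightPoly x + (w - x i) * G.linkWeight i x := by
  unfold RGraph.weightPoly RGraph.linkWeight
  rw [← Finset.sum_filter_add_sum_filter_not G.edges (i ∈ ·),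
    ← Finset.sum_filter_add_sum_filter_not G.edges (i ∈ ·) (fun e => ∏ i ∈ e, x i)]
  have h1 : ∀ e ∈ G.edges.filter (i ∈ ·), ∏ j ∈ e, Function.update x i w j
      = ∏ j ∈ e, x j + (w - x i) * ∏ j ∈ e.erase i, x j := by
    intro e he
    have hi := (Finset.mem_filter.mp he).2
    rw [← Finset.mul_prod_erase e _ hi, ← Finset.mul_prod_erase e x hi, Function.update_self,
      Finset.prod_congr rfl fun j hj => Function.update_of_ne (Finset.ne_of_mem_erase hj) w x]
    ring
  have h2 : ∀ e ∈ G.edges.filter (i ∉ ·), ∏ j ∈ e, Function.update x i w j = ∏ j ∈ e, x j := by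
    intro e he
    refine Finset.prod_congr rfl fun j hj => Function.update_of_ne ?_ w x
    rintro rfl
    exact (Finset.mem_filter.mp he).2 hj
  rw [Finset.sum_congr rfl h1, Finset.sum_congr rfl h2, Finset.sum_add_distrib, Finset.mul_sum]
  ring

end WeightPoly

/-! ### Bounds on Lagrangians and on optimal weightings -/

section Lagrangian

variable {V : Type*} [Fintype V] {r : ℕ}

theorem RGraph.bddAbove_weightPoly (G : RGraph V r) :
    BddAbove (G.weightPoly '' stdSimplex ℝ V) := by
  have hc : Continuous G.weightPoly := by
    unfold RGraph.weightPoly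
    fun_prop
  exact ((isCompact_stdSimplex ℝ V).image hc).bddAbove

theorem RGraph.weightPoly_le_lagrangian (G : RGraph V r) {x : V → ℝ} (hx : x ∈ stdSimplex ℝ V) :
    G.weightPoly x ≤ G.lagrangian :=
  le_csSup G.bddAbove_weightPoly ⟨x, hx, rfl⟩

theorem weightPoly_completeRGraph (n r : ℕ) (x : Fin n → ℝ) :
    (completeRGraph n r).weightPoly x = elemSymm Finset.univ r x := rfl

theorem choose_div_pow_le_lagrangian {n : ℕ} (hn : 0 < n) (r : ℕ) :
    (n.choose r : ℝ) / (n : ℝ) ^ r ≤ (completeRGraph n r).lagrangian := by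
  have hn' : (n : ℝ) ≠ 0 := by exact_mod_cast hn.ne'
  have hmem : (fun _ => (n : ℝ)⁻¹) ∈ stdSimplex ℝ (Fin n) :=
    ⟨fun _ => by positivity, by simp [hn']⟩
  refine le_trans (le_of_eq ?_) ((completeRGraph n r).weightPoly_le_lagrangian hmem)
  rw [weightPoly_completeRGraph, elemSymm, Finset.sum_congr rfl (g := fun _ => ((n : ℝ)⁻¹) ^ r)]
  · simp [div_eq_mul_inv]
  · intro e he
    rw [Finset.prod_const, (Finset.mem_powersetCard.mp he).2]

theorem lagrangian_completeRGraph_nonneg {n : ℕ} (hn : 0 < n) (r : ℕ) :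
    0 ≤ (completeRGraph n r).lagrangian :=
  le_trans (by positivity) (choose_div_pow_le_lagrangian hn r)

variable [DecidableEq V]

theorem RGraph.weightPoly_add_sum_compl (G : RGraph V r) (x : V → ℝ) :
    G.weightPoly x + ∑ e ∈ Finset.univ.powersetCard r \ G.edges, ∏ i ∈ e, x i
      = elemSymm Finset.univ r x := by
  unfold RGraph.weightPoly elemSymm
  rw [add_comm]
  exact Finset.sum_sdiff
    (fun e he => Finset.mem_powersetCard.mpr ⟨Finset.subset_univ e, G.card_eq e he⟩)

theorem elemSymm_le_lagrangian_of_eq_zero {n : ℕ} (hV : Fintype.card V = n + 1) {x : V → ℝ}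
    (hx : x ∈ stdSimplex ℝ V) {p : V} (hp : x p = 0) :
    elemSymm Finset.univ r x ≤ (completeRGraph n r).lagrangian := by
  have hc : Fintype.card {i : V // i ≠ p} = n := by
    rw [Fintype.card_subtype_compl, Fintype.card_subtype_eq, hV, Nat.add_sub_cancel]
  let f : Fin n ↪ V :=
    (Fintype.equivFinOfCardEq hc).symm.toEmbedding.trans (Function.Embedding.subtype _)
  have hf : Finset.univ.map f = Finset.univ.erase p := by
    ext i
    simp only [Finset.mem_map, Finset.mem_univ, true_and, Finset.mem_erase, and_true]
    constructor
    · rintro ⟨a, rfl⟩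
      exact ((Fintype.equivFinOfCardEq hc).symm a).2
    · intro hi
      exact ⟨Fintype.equivFinOfCardEq hc ⟨i, hi⟩, by simp [f]⟩
  have hmem : x ∘ f ∈ stdSimplex ℝ (Fin n) := by
    refine ⟨fun i => hx.1 _, ?_⟩
    have : ∑ i, (x ∘ f) i = ∑ i ∈ Finset.univ.map f, x i := by simp
    rw [this, hf, ← hx.2, ← Finset.add_sum_erase _ _ (Finset.mem_univ p), hp, zero_add]
  rw [elemSymm_erase_of_eq_zero (Finset.mem_univ p) hp, ← hf, elemSymm_map,
    ← weightPoly_completeRGraph]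
  exact RGraph.weightPoly_le_lagrangian _ hmem

/-- Without the edges through both `p` and `q`, the complete `r`-graph on `n + 1` vertices has
weight at most the Lagrangian of the complete `r`-graph on `n` vertices. -/
theorem elemSymm_sub_le_lagrangian {n : ℕ} (hV : Fintype.card V = n + 1) {x : V → ℝ}
    (hx : x ∈ stdSimplex ℝ V) {p q : V} (hpq : p ≠ q) :
    elemSymm Finset.univ (r + 2) x
        - x p * x q * elemSymm ((Finset.univ.erase p).erase q) r x
      ≤ (completeRGraph n (r + 2)).lagrangian := by
  have hq : q ∈ Finset.univ.erase p := by simp [hpq.symm]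
  -- Without the terms containing both `p` and `q`, the polynomial depends on `x p` and `x q` only
  -- through their sum, so all of it may sit at `q`.
  set y : V → ℝ := Function.update (Function.update x q (x p + x q)) p 0 with hy
  have hyp : y p = 0 := by simp [hy]
  have hyq : y q = x p + x q := by simp [hy, hpq.symm]
  have hyi : ∀ i ∈ (Finset.univ.erase p).erase q, y i = x i := by
    intro i hi
    simp only [Finset.mem_erase, Finset.mem_univ, and_true] at hi
    simp [hy, hi.1, hi.2]
  have hmem : y ∈ stdSimplex ℝ V := by
    constructor
    · intro i
      by_cases hip : i = p
      · rw [hip, hyp]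
      by_cases hiq : i = q
      · rw [hiq, hyq]; exact add_nonneg (hx.1 p) (hx.1 q)
      rw [hyi i (by simp [hip, hiq])]; exact hx.1 i
    · rw [← hx.2, ← Finset.add_sum_erase _ _ (Finset.mem_univ p), ← Finset.add_sum_erase _ _ hq,
        ← Finset.add_sum_erase _ x (Finset.mem_univ p), ← Finset.add_sum_erase _ x hq, hyp, hyq,
        Finset.sum_congr rfl hyi]
      ring
  refine le_trans (le_of_eq ?_) (elemSymm_le_lagrangian_of_eq_zero hV hmem hyp)
  rw [elemSymm_erase_of_eq_zero (Finset.mem_univ p) hyp, elemSymm_eq_erase hq, hyq,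
    elemSymm_congr hyi, elemSymm_congr hyi, elemSymm_eq_erase (Finset.mem_univ p),
    elemSymm_eq_erase (x := x) hq, elemSymm_eq_erase (x := x) hq]
  ring

theorem RGraph.linkWeight_le_elemSymm (G : RGraph V (r + 1)) {x : V → ℝ} (hx : ∀ i, 0 ≤ x i)
    (i : V) : G.linkWeight i x ≤ elemSymm (Finset.univ.erase i) r x := by
  unfold RGraph.linkWeight elemSymm
  rw [← Finset.sum_image (s := G.edges.filter (i ∈ ·)) (g := fun e => e.erase i)
    (f := fun e => ∏ j ∈ e, x j)]
  · refine Finset.sum_le_sum_of_subset_of_nonneg ?_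
      fun _ _ _ => Finset.prod_nonneg fun i _ => hx i
    intro e he
    obtain ⟨f, hf, rfl⟩ := Finset.mem_image.mp he
    obtain ⟨hf, hi⟩ := Finset.mem_filter.mp hf
    rw [Finset.mem_powersetCard, Finset.card_erase_of_mem hi, G.card_eq f hf]
    exact ⟨Finset.erase_subset_erase i (Finset.subset_univ f), rfl⟩
  · intro e he f hf h
    dsimp only at h
    rw [← Finset.insert_erase (Finset.mem_filter.mp he).2, h,
      Finset.insert_erase (Finset.mem_filter.mp hf).2]

/-- Lagrange multiplier condition at a maximum point of `λ(G, ·)`. -/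
theorem RGraph.mul_lagrangian_le_linkWeight (G : RGraph V (r + 1)) {x : V → ℝ}
    (hx : x ∈ stdSimplex ℝ V) (hmax : G.weightPoly x = G.lagrangian) (hL : 0 ≤ G.lagrangian)
    {i : V} (hi : 0 < x i) : ((r : ℝ) + 1) * G.lagrangian ≤ G.linkWeight i x := by
  have key : ∀ h : ℝ, 0 < h → h ≤ x i →
      ((r : ℝ) + 1) * G.lagrangian ≤ (1 + h) ^ r * G.linkWeight i x := by
    intro h h0 hxi
    have h1 : (0 : ℝ) < 1 + h := by linarith
    -- Removing `h / (1 + h)` from the weight of `i` leaves total `1 / (1 + h)`, and scaling by `1 +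
    -- h` restores 1. Comparison with the maximum, Bernoulli's inequality and then `h → 0` give the
    -- claim.
    set y : V → ℝ := fun j => (1 + h) * Function.update x i (x i - h / (1 + h)) j with hy
    have hmem : y ∈ stdSimplex ℝ V := by
      constructor
      · intro j
        refine mul_nonneg h1.le ?_
        by_cases hj : j = i
        · subst hj
          rw [Function.update_self, sub_nonneg, div_le_iff₀ h1]
          nlinarith
        · rw [Function.update_of_ne hj]; exact hx.1 j
      · rw [hy, ← Finset.mul_sum, Finset.sum_update_of_mem (Finset.mem_univ i)]
        have := hx.2
        rw [← Finset.add_sum_erase _ _ (Finset.mem_univ i), Finset.erase_eq] at this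
        rw [sub_add_eq_add_sub, this]
        field_simp
        ring
    have hle := G.weightPoly_le_lagrangian hmem
    rw [hy, G.weightPoly_smul, G.weightPoly_update, hmax] at hle
    have e1 : (1 + h) ^ (r + 1) * (G.lagrangian +
        (x i - h / (1 + h) - x i) * G.linkWeight i x)
        = (1 + h) ^ (r + 1) * G.lagrangian - h * ((1 + h) ^ r * G.linkWeight i x) := by
      field_simp
      ring
    rw [e1] at hle
    have hb := one_add_mul_le_pow (a := h) (by linarith) (r + 1)
    push_cast at hb
    have := mul_le_mul_of_nonneg_right hb hL
    refine le_of_mul_le_mul_left ?_ h0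
    nlinarith
  have ht : Filter.Tendsto (fun h : ℝ => (1 + h) ^ r * G.linkWeight i x)
      (nhdsWithin 0 (Set.Ioi 0)) (nhds (G.linkWeight i x)) := by
    have hc : Continuous fun h : ℝ => (1 + h) ^ r * G.linkWeight i x := by fun_prop
    have := hc.tendsto 0
    simp only [add_zero, one_pow, one_mul] at this
    exact this.mono_left nhdsWithin_le_nhds
  refine ge_of_tendsto ht ?_
  filter_upwards [Ioc_mem_nhdsGT hi] with h hh using key h hh.1 hh.2

/-- In an optimal weighting of an `r`-graph on `n + 1` vertices whose Lagrangian exceeds that of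
the complete `r`-graph on `n` vertices, no weight exceeds `1 / (n + 1 - r)`. -/
theorem RGraph.weight_le_of_lagrangian_lt {n : ℕ} (hV : Fintype.card V = n + 1) (hr : 1 ≤ r)
    (hn : r < n) (G : RGraph V (r + 1))
    (hG : (completeRGraph n (r + 1)).lagrangian < G.lagrangian) {x : V → ℝ}
    (hx : x ∈ stdSimplex ℝ V) (hmax : G.weightPoly x = G.lagrangian) (i : V) :
    x i ≤ 1 / ((n : ℝ) - r) := by
  have hn0 : 0 < n := by omega
  have hnr : (0 : ℝ) < (n : ℝ) - r := by rw [sub_pos]; exact_mod_cast hn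
  have hnR : (0 : ℝ) < n := by exact_mod_cast hn0
  rcases (hx.1 i).eq_or_lt with h0 | hi
  · rw [← h0]; positivity
  have hcard : (Finset.univ.erase i).card = n := by
    rw [Finset.card_erase_of_mem (Finset.mem_univ i), Finset.card_univ, hV, Nat.add_sub_cancel]
  have hsum : ∑ j ∈ Finset.univ.erase i, x j = 1 - x i := by
    rw [← hx.2, ← Finset.add_sum_erase _ _ (Finset.mem_univ i)]; ring
  have hx1 : x i ≤ 1 := by
    have := Finset.sum_nonneg fun j (_ : j ∈ Finset.univ.erase i) => hx.1 j
    linarith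
  have hL := lagrangian_completeRGraph_nonneg hn0 (r + 1)
  have h1 := G.mul_lagrangian_le_linkWeight hx hmax (hL.trans hG.le) hi
  have h2 := (G.linkWeight_le_elemSymm hx.1 i).trans
    (elemSymm_le_maclaurin (fun j _ => hx.1 j) r (by omega))
  rw [hcard, hsum] at h2
  have h3 := (choose_div_pow_le_lagrangian hn0 (r + 1)).trans_lt hG
  have hch : (n.choose (r + 1) : ℝ) * (r + 1) = n.choose r * ((n : ℝ) - r) := by
    have := Nat.choose_succ_right_eq n r
    rw [← Nat.cast_sub hn.le]
    exact_mod_cast this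
  have hcpos : (0 : ℝ) < n.choose r := by exact_mod_cast Nat.choose_pos hn.le
  -- The uniform weighting bounds the Lagrangian below, Maclaurin bounds the derivative above; the
  -- common binomial factor cancels.
  have h4 : ((n : ℝ) - r) < n * (1 - x i) ^ r := by
    have h5 : ((r : ℝ) + 1) * ((n.choose (r + 1) : ℝ) / (n : ℝ) ^ (r + 1))
        < n.choose r * ((1 - x i) / n) ^ r :=
      (mul_lt_mul_of_pos_left h3 (by positivity)).trans_le (h1.trans h2)
    have h6 : ((r : ℝ) + 1) * ((n.choose (r + 1) : ℝ) / (n : ℝ) ^ (r + 1))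
        = (n.choose r / (n : ℝ) ^ (r + 1)) * ((n : ℝ) - r) := by
      rw [← mul_div_assoc, mul_comm, hch]; ring
    have h7 : (n.choose r : ℝ) * ((1 - x i) / n) ^ r
        = (n.choose r / (n : ℝ) ^ (r + 1)) * (n * (1 - x i) ^ r) := by
      rw [div_pow, pow_succ]; field_simp
    rw [h6, h7] at h5
    exact lt_of_mul_lt_mul_left h5 (by positivity)
  have h8 : (1 - x i) ^ r * (1 + r * x i) ≤ 1 := by
    have hb := one_add_mul_le_pow (a := x i) (by linarith) r
    calc (1 - x i) ^ r * (1 + r * x i) ≤ (1 - x i) ^ r * (1 + x i) ^ r :=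
          mul_le_mul_of_nonneg_left hb (pow_nonneg (by linarith) r)
      _ = (1 - x i ^ 2) ^ r := by rw [← mul_pow]; ring
      _ ≤ 1 := pow_le_one₀ (by nlinarith) (by nlinarith)
  have hrR : (0 : ℝ) < r := by exact_mod_cast hr
  have h9 : ((n : ℝ) - r) * (1 + r * x i) ≤ n := by
    have : (0 : ℝ) ≤ 1 + r * x i := by positivity
    calc ((n : ℝ) - r) * (1 + r * x i) ≤ n * (1 - x i) ^ r * (1 + r * x i) := by gcongr
      _ = n * ((1 - x i) ^ r * (1 + r * x i)) := by ring
      _ ≤ n * 1 := by gcongr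
      _ = n := mul_one _
  rw [le_div_iff₀ hnr]
  refine le_of_mul_le_mul_left ?_ hrR
  linarith

end Lagrangian

/-! ### Counting estimates -/

/-- Union bound: choose three elements of `S` in the set, then complete it arbitrarily. -/
theorem card_filter_three_le_inter {V : Type*} [Fintype V] [DecidableEq V] (S : Finset V) (r : ℕ) :
    ((Finset.univ.powersetCard (r + 3)).filter fun e : Finset V => 3 ≤ (e ∩ S).card).card
      ≤ S.card.choose 3 * (Fintype.card V - 3).choose r := by
  have hsub : ((Finset.univ.powersetCard (r + 3)).filter fun e : Finset V => 3 ≤ (e ∩ S).card)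
      ⊆ (S.powersetCard 3).biUnion fun T => ((Finset.univ \ T).powersetCard r).image (T ∪ ·) := by
    intro e he
    obtain ⟨he, h3⟩ := Finset.mem_filter.mp he
    obtain ⟨T, hT, hT3⟩ := Finset.exists_subset_card_eq h3
    have hTe : T ⊆ e := hT.trans Finset.inter_subset_left
    refine Finset.mem_biUnion.mpr ⟨T, Finset.mem_powersetCard.mpr
      ⟨hT.trans Finset.inter_subset_right, hT3⟩, Finset.mem_image.mpr ⟨e \ T, ?_, ?_⟩⟩
    · rw [Finset.mem_powersetCard, Finset.card_sdiff_of_subset hTe, hT3,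
        (Finset.mem_powersetCard.mp he).2]
      exact ⟨Finset.sdiff_subset_sdiff (Finset.subset_univ e) le_rfl, rfl⟩
    · exact Finset.union_sdiff_of_subset hTe
  refine (Finset.card_le_card hsub).trans ?_
  rw [← Finset.card_powersetCard 3 S]
  refine Finset.card_biUnion_le_card_mul _ _ _ fun T hT => Finset.card_image_le.trans ?_
  rw [Finset.card_powersetCard, Finset.card_univ_sdiff, (Finset.mem_powersetCard.mp hT).2]

/-- The number of missing edges outweighs both the edges with at least three light vertices and
all edges through a fixed pair of vertices, the latter with a factor `2 ^ k`. -/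
theorem two_pow_mul_choose_add_le {k N : ℕ} (hk : 2 ≤ k) (hN : k < N)
    (h : (k + 2) * 2 ^ k * ((N.choose k : ℝ) - 1) ≤ N.choose (k + 1)) :
    (2 : ℝ) ^ k * N.choose k + (2 * k + 4).choose 3 * (N - 1).choose (k - 1)
      ≤ N.choose k + (k + 2) * 2 ^ k * ((N.choose k : ℝ) - 1) := by
  obtain ⟨j, rfl⟩ : ∃ j, k = j + 1 := ⟨k - 1, by omega⟩
  obtain ⟨M, rfl⟩ : ∃ M, N = M + 1 := ⟨N - 1, by omega⟩
  simp only [Nat.add_sub_cancel]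
  have e1 : ((M : ℝ) + 1) * M.choose j = (M + 1).choose (j + 1) * (j + 1) := by
    exact_mod_cast Nat.add_one_mul_choose_eq M j
  have e2 : ((M + 1).choose (j + 1 + 1) : ℝ) * (j + 2)
      = (M + 1).choose (j + 1) * ((M : ℝ) - j) := by
    have := Nat.choose_succ_right_eq (M + 1) (j + 1)
    have h' : ((M + 1 - (j + 1) : ℕ) : ℝ) = (M : ℝ) - j := by
      rw [Nat.cast_sub hN.le]; push_cast; ring
    rw [← h']
    have h2 : ((j : ℝ) + 2) = ((j + 1 + 1 : ℕ) : ℝ) := by push_cast; ring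
    rw [h2]
    exact_mod_cast this
  have e3 : (j + 1 : ℝ) ≤ M.choose j := by
    have h1 : (j + 1).choose j ≤ M.choose j := Nat.choose_le_choose j (by omega)
    rw [Nat.choose_succ_self_right] at h1
    exact_mod_cast h1
  have e4 : (3 : ℝ) * (2 * (j + 1 : ℕ) + 4).choose 3 = 2 * (j + 3) * (j + 2) * (2 * j + 5) := by
    have := Nat.descFactorial_eq_factorial_mul_choose (2 * (j + 1) + 4) 3
    have h6 : (2 * (j + 1) + 4).descFactorial 3
        = (2 * j + 4) * ((2 * j + 5) * (2 * j + 6)) := by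
      simp only [Nat.descFactorial_succ, Nat.descFactorial_zero]
      rw [show 2 * (j + 1) + 4 - 2 = 2 * j + 4 by omega,
        show 2 * (j + 1) + 4 - 1 = 2 * j + 5 by omega,
        show 2 * (j + 1) + 4 - 0 = 2 * j + 6 by omega, mul_one]
    rw [h6] at this
    have h7 : ((2 * j + 4) * ((2 * j + 5) * (2 * j + 6)) : ℝ)
        = 6 * (2 * (j + 1) + 4 : ℕ).choose 3 := by exact_mod_cast this
    linarith
  -- This fails at `j = 0`, so `2 ≤ k` is needed here.
  have e5 : (4 : ℝ) * (2 * j + 5) ≤ 3 * (2 ^ (j + 1) * 2 ^ (j + 1)) := by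
    have : ∀ j : ℕ, 1 ≤ j → 4 * (2 * j + 5) ≤ 3 * (2 ^ (j + 1) * 2 ^ (j + 1)) := by
      intro j hj
      induction j, hj using Nat.le_induction with
      | base => norm_num
      | succ m hm ih => rw [pow_succ 2 (m + 1)]; nlinarith
    exact_mod_cast this j (by omega)
  have hj : (1 : ℝ) ≤ j := by exact_mod_cast (by omega : 1 ≤ j)
  have hjM : (j : ℝ) + 1 ≤ M := by exact_mod_cast (by omega : j + 1 ≤ M)
  have hP : (1 : ℝ) ≤ 2 ^ (j + 1) := one_le_pow₀ (by norm_num)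
  push_cast at h ⊢
  generalize ((M + 1).choose (j + 1) : ℝ) = C at *
  generalize ((M + 1).choose (j + 1 + 1) : ℝ) = D at *
  generalize (M.choose j : ℝ) = B at *
  generalize ((2 * (j + 1) + 4).choose 3 : ℝ) = A at *
  generalize (2 : ℝ) ^ (j + 1) = P at *
  have hCM : (M : ℝ) + 1 ≤ C := by nlinarith
  have hC0 : 0 < C := by linarith
  -- The hypothesis `h` makes `M` exponentially large in `j`; hence `B` is small compared with `C`,
  -- since `(M + 1) * B = (j + 1) * C`.
  have hK : ((j : ℝ) + 2) * ((j + 3) * P) ≤ 2 * (M - j) := by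
    have h1 : (j + 2) * ((j + 3) * P) * (C / 2) ≤ (M - j) * C := by
      calc (j + 2) * ((j + 3) * P) * (C / 2) ≤ (j + 2) * ((j + 3) * P) * (C - 1) := by
            gcongr; linarith
        _ = (j + 1 + 2) * P * (C - 1) * (j + 2) := by ring
        _ ≤ D * (j + 2) := by gcongr
        _ = (M - j) * C := by rw [e2]; ring
    nlinarith
  have hKpos : 0 < ((j : ℝ) + 3) * P := by positivity
  have hB : ((j : ℝ) + 3) * P * B ≤ 2 * C := by
    have h1 : (j + 2) * ((j + 3) * P * B) ≤ (j + 2) * (2 * C) := by nlinarith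
    exact le_of_mul_le_mul_left h1 (by positivity)
  have hKC : ((j : ℝ) + 3) * P ≤ C := by nlinarith
  have hA : 2 * A ≤ ((j : ℝ) + 3) * P * ((j + 2) * P) := by
    have : 0 ≤ ((j : ℝ) + 3) * (j + 2) := by positivity
    nlinarith
  have hAB : A * B ≤ (j + 2) * P * C := by
    have hA0 : 0 ≤ A := by
      have : 0 ≤ 2 * ((j : ℝ) + 3) * (j + 2) * (2 * j + 5) := by positivity
      linarith
    have h1 : ((j : ℝ) + 3) * P * (A * B) ≤ (j + 3) * P * ((j + 2) * P * C) := by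
      calc ((j : ℝ) + 3) * P * (A * B) = A * ((j + 3) * P * B) := by ring
        _ ≤ A * (2 * C) := by gcongr
        _ = 2 * A * C := by ring
        _ ≤ ((j : ℝ) + 3) * P * ((j + 2) * P) * C := by gcongr
        _ = _ := by ring
    exact le_of_mul_le_mul_left h1 hKpos
  nlinarith

/-! ### The weight of the missing edges -/

section MissingEdges

variable {V : Type*} [Fintype V]

theorem card_light_le {n k : ℕ} (hV : Fintype.card V = n + 1) (hn : k + 1 < n) {x : V → ℝ}
    (hx : x ∈ stdSimplex ℝ V) {v : ℝ} (hv : v * ((n : ℝ) - (k + 1)) = 1)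
    (hxv : ∀ i, x i ≤ v) : (Finset.univ.filter fun i => x i ≤ v / 2).card ≤ 2 * k + 4 := by
  have hnk : (0 : ℝ) < (n : ℝ) - (k + 1) := by
    rw [sub_pos]; exact_mod_cast hn
  have hv0 : 0 < v := by
    by_contra hc
    nlinarith
  -- The total deficit below `v` is `(n + 1) * v - 1`, and each light vertex accounts for at least
  -- `v / 2` of it.
  have h1 : ∑ i, (v - x i) = (k + 2) * v := by
    rw [Finset.sum_sub_distrib, hx.2, Finset.sum_const, Finset.card_univ, hV, nsmul_eq_mul, ← hv]
    push_cast
    ring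
  have h2 : ((Finset.univ.filter fun i => x i ≤ v / 2).card : ℝ) * (v / 2) ≤ (k + 2) * v := by
    rw [← h1, ← nsmul_eq_mul]
    refine (Finset.card_nsmul_le_sum _ (fun i => v - x i) _ fun i hi => ?_).trans
      (Finset.sum_le_univ_sum_of_nonneg fun i => sub_nonneg.mpr (hxv i))
    have := (Finset.mem_filter.mp hi).2
    linarith
  have h3 : ((Finset.univ.filter fun i => x i ≤ v / 2).card : ℝ) ≤ 2 * k + 4 := by
    refine le_of_mul_le_mul_right ?_ (half_pos hv0)
    linarith
  exact_mod_cast h3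

variable [DecidableEq V]

theorem mul_pow_le_prod {k : ℕ} {x : V → ℝ} (hx : ∀ i, 0 ≤ x i) {c : ℝ} (hc : 0 ≤ c) {p q : V}
    (hp : ∀ i, x p ≤ x i) (hq : ∀ i, i ≠ p → x q ≤ x i) {e : Finset V} (he : e.card = k + 2)
    (hS : (e ∩ Finset.univ.filter fun i => x i ≤ c).card ≤ 2) :
    x p * x q * c ^ k ≤ ∏ i ∈ e, x i := by
  -- `T` is a pair in `e` containing all its light vertices: its product is at least `x p * x q`,
  -- and each of the other `k` weights exceeds `c`.
  obtain ⟨T, hT1, hTe, hT⟩ := Finset.exists_subsuperset_card_eq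
    (Finset.inter_subset_left (s₁ := e)) hS (by omega : 2 ≤ e.card)
  rw [← Finset.prod_sdiff hTe, mul_comm]
  have hcard : (e \ T).card = k := by rw [Finset.card_sdiff_of_subset hTe, he, hT]; omega
  refine mul_le_mul ?_ ?_ (mul_nonneg (hx p) (hx q)) (Finset.prod_nonneg fun i _ => hx i)
  · rw [← hcard, ← Finset.prod_const]
    refine Finset.prod_le_prod (fun _ _ => hc) fun i hi => ?_
    obtain ⟨hie, hiT⟩ := Finset.mem_sdiff.mp hi
    by_contra hlt
    exact hiT (hT1 (Finset.mem_inter.mpr ⟨hie, by simpa using (not_le.mp hlt).le⟩))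
  · obtain ⟨a, b, hab, rfl⟩ := Finset.card_eq_two.mp hT
    rw [Finset.prod_pair hab]
    by_cases hap : a = p
    · rw [hap]
      exact mul_le_mul_of_nonneg_left (hq b fun h => hab (hap.trans h.symm)) (hx p)
    · rw [mul_comm]
      exact mul_le_mul (hq a hap) (hp b) (hx p) (hx a)

/-- An `r`-graph on `n + 1` vertices with sufficiently many missing edges has Lagrangian at most
that of the complete `r`-graph on `n` vertices (here `r = k + 2`). -/
theorem RGraph.lagrangian_le_of_card_compl {n k : ℕ} (hk : 2 ≤ k) (hn : k + 1 < n)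
    (hV : Fintype.card V = n + 1) (G : RGraph V (k + 2))
    (hsize : (k + 2) * 2 ^ k * (((n - 1).choose k : ℝ) - 1) ≤ (n - 1).choose (k + 1))
    (hmiss : ((n - 1).choose k : ℝ) + (k + 2) * 2 ^ k * (((n - 1).choose k : ℝ) - 1)
      ≤ (Finset.univ.powersetCard (k + 2) \ G.edges).card) :
    G.lagrangian ≤ (completeRGraph n (k + 2)).lagrangian := by
  by_contra! hG
  have : Nonempty V := Fintype.card_pos_iff.mp (by omega)
  obtain ⟨⟨x, hx, hmax⟩, -⟩ := G.isGreatest_lagrangian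
  have hnk : (0 : ℝ) < (n : ℝ) - (k + 1) := by rw [sub_pos]; exact_mod_cast hn
  set v : ℝ := 1 / ((n : ℝ) - (k + 1)) with hvdef
  have hv : v * ((n : ℝ) - (k + 1)) = 1 := one_div_mul_cancel hnk.ne'
  have hv0 : 0 < v := by positivity
  have hxv : ∀ i, x i ≤ v := fun i => by
    have := G.weight_le_of_lagrangian_lt hV (by omega) hn hG hx hmax i
    rwa [Nat.cast_add, Nat.cast_one] at this
  obtain ⟨p, hp⟩ := Finite.exists_min x
  have hne : (Finset.univ.erase p).Nonempty := by
    rw [← Finset.card_pos, Finset.card_erase_of_mem (Finset.mem_univ p), Finset.card_univ]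
    omega
  obtain ⟨q, hqp, hq⟩ := Finset.exists_min_image (Finset.univ.erase p) x hne
  have hpq : p ≠ q := (Finset.ne_of_mem_erase hqp).symm
  set S : Finset V := Finset.univ.filter fun i => x i ≤ v / 2 with hS
  set M : Finset (Finset V) := Finset.univ.powersetCard (k + 2) \ G.edges with hM
  have hMcard : ∀ e ∈ M, e.card = k + 2 := fun e he =>
    (Finset.mem_powersetCard.mp (Finset.mem_sdiff.mp he).1).2
  have hScard : S.card ≤ 2 * k + 4 := card_light_le hV hn hx hv hxv
  have hheavy : ((M.filter fun e => 3 ≤ (e ∩ S).card).card : ℝ)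
      ≤ (2 * k + 4).choose 3 * (n - 1 - 1).choose (k - 1) := by
    have h1 := card_filter_three_le_inter S (k - 1)
    rw [show k - 1 + 3 = k + 2 by omega, hV, show n + 1 - 3 = n - 1 - 1 by omega] at h1
    have h2 := Finset.card_le_card (Finset.filter_subset_filter (fun e => 3 ≤ (e ∩ S).card)
      (Finset.sdiff_subset (s := Finset.univ.powersetCard (k + 2)) (t := G.edges)))
    exact_mod_cast h2.trans (h1.trans (Nat.mul_le_mul_right _ (Nat.choose_le_choose 3 hScard)))
  have hsplit : ((M.filter fun e => 3 ≤ (e ∩ S).card).card : ℝ)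
      + (M.filter fun e => ¬ 3 ≤ (e ∩ S).card).card = M.card := by
    exact_mod_cast Finset.card_filter_add_card_filter_not (s := M) (fun e => 3 ≤ (e ∩ S).card)
  have harith := two_pow_mul_choose_add_le hk (by omega : k < n - 1) hsize
  have hcount : (2 : ℝ) ^ k * (n - 1).choose k
      ≤ (M.filter fun e => ¬ 3 ≤ (e ∩ S).card).card := by linarith
  have hpq0 : 0 ≤ x p * x q := mul_nonneg (hx.1 p) (hx.1 q)
  have hM1 : ((M.filter fun e => ¬ 3 ≤ (e ∩ S).card).card : ℝ) * (x p * x q * (v / 2) ^ k)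
      ≤ ∑ e ∈ M, ∏ i ∈ e, x i := by
    rw [← nsmul_eq_mul]
    refine (Finset.card_nsmul_le_sum _ (fun e => ∏ i ∈ e, x i) _ fun e he => ?_).trans
      (Finset.sum_le_sum_of_subset_of_nonneg (Finset.filter_subset _ _)
        fun _ _ _ => Finset.prod_nonneg fun i _ => hx.1 i)
    obtain ⟨heM, he2⟩ := Finset.mem_filter.mp he
    exact mul_pow_le_prod hx.1 (by positivity) hp
      (fun i hi => hq i (Finset.mem_erase.mpr ⟨hi, Finset.mem_univ i⟩)) (hMcard e heM)
      (Nat.lt_succ_iff.mp (not_le.mp he2))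
  have hM2 : x p * x q * ((n - 1).choose k * v ^ k) ≤ ∑ e ∈ M, ∏ i ∈ e, x i := by
    refine le_trans ?_ hM1
    calc x p * x q * ((n - 1).choose k * v ^ k)
        = (2 ^ k * (n - 1).choose k) * (x p * x q * (v / 2) ^ k) := by
          rw [show (v / 2) ^ k = v ^ k / 2 ^ k from div_pow v 2 k, mul_div_assoc', mul_div_assoc',
            eq_div_iff (by positivity)]
          ring
      _ ≤ _ := by gcongr
  have hcardU : ((Finset.univ.erase p).erase q).card = n - 1 := by
    rw [Finset.card_erase_of_mem hqp, Finset.card_erase_of_mem (Finset.mem_univ p),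
      Finset.card_univ, hV, Nat.add_sub_cancel]
  have hU := elemSymm_le_choose_mul_pow (s := (Finset.univ.erase p).erase q) (k := k)
    (fun i _ => hx.1 i) (fun i _ => hxv i)
  rw [hcardU] at hU
  have h1 := elemSymm_sub_le_lagrangian (r := k) hV hx hpq
  have h2 := G.weightPoly_add_sum_compl x
  have h3 := mul_le_mul_of_nonneg_left hU hpq0
  rw [hmax] at h2
  linarith

end MissingEdges

/-! ### Initial segments of the colex order -/

/-- In a finite linear order, exactly `m` elements have fewer than `m` predecessors. -/
theorem card_filter_card_lt {α : Type*} [LinearOrder α] (s : Finset α) (m : ℕ) (hm : m ≤ s.card) :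
    (s.filter fun a => (s.filter (· < a)).card < m).card = m := by
  induction s using Finset.induction_on_max with
  | empty => simpa using (Nat.le_zero.mp hm).symm
  | insert a s ha ih =>
    have has : a ∉ s := fun h => lt_irrefl a (ha a h)
    have h1 : (insert a s).filter (· < a) = s := by
      ext b
      simp only [Finset.mem_filter, Finset.mem_insert]
      exact ⟨fun ⟨h, hb⟩ => h.resolve_left hb.ne, fun h => ⟨Or.inr h, ha b h⟩⟩
    have h2 : ∀ b ∈ s, (insert a s).filter (· < b) = s.filter (· < b) := fun b hb => by
      rw [Finset.filter_insert, if_neg (ha b hb).not_gt]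
    have h3 : (s.filter fun b => ((insert a s).filter (· < b)).card < m)
        = s.filter fun b => (s.filter (· < b)).card < m :=
      Finset.filter_congr fun b hb => by rw [h2 b hb]
    rw [Finset.filter_insert, h1, h3]
    rw [Finset.card_insert_of_notMem has] at hm
    split_ifs with hc
    · have h4 : (s.filter fun b => (s.filter (· < b)).card < m) = s :=
        Finset.filter_true_of_mem fun b _ =>
          (Finset.card_le_card (Finset.filter_subset _ s)).trans_lt hc
      rw [h4, Finset.card_insert_of_notMem has]
      omega
    · exact ih (not_lt.mp hc)

/-- The `r`-subsets of an initial segment of `ℕ` are closed downwards in colex, so predecessors can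
be counted inside a finite set. -/
theorem mem_powersetCard_range_of_colex_lt {t r : ℕ} {A B : Finset ℕ}
    (hA : A ∈ (Finset.range t).powersetCard r) (hB : B.card = r) (h : toColex B < toColex A) :
    B ∈ (Finset.range t).powersetCard r := by
  obtain ⟨hA, -⟩ := Finset.mem_powersetCard.mp hA
  refine Finset.mem_powersetCard.mpr ⟨fun b hb => Finset.mem_range.mpr ?_, hB⟩
  exact Finset.Colex.forall_lt_mono h.le (fun a ha => Finset.mem_range.mp (hA ha)) b hb

theorem ncard_colex_lt {t r : ℕ} {A : Finset ℕ} (hA : A ∈ (Finset.range t).powersetCard r) :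
    {B : Finset ℕ | B.card = r ∧ toColex B < toColex A}.ncard
      = (((Finset.range t).powersetCard r).filter fun B => toColex B < toColex A).card := by
  rw [← Set.ncard_coe_finset]
  congr 1
  ext B
  simp only [Set.mem_ofPred_eq, Finset.coe_filter]
  exact ⟨fun ⟨h1, h2⟩ => ⟨mem_powersetCard_range_of_colex_lt hA h1 h2, h2⟩,
    fun ⟨h1, h2⟩ => ⟨(Finset.mem_powersetCard.mp h1).2, h2⟩⟩

theorem mem_firstColex_of_subset_range {n r m : ℕ} (hm : n.choose r ≤ m) {A : Finset ℕ}
    (hA : A ∈ (Finset.range n).powersetCard r) : A ∈ firstColex r m := by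
  refine ⟨(Finset.mem_powersetCard.mp hA).2, ?_⟩
  rw [ncard_colex_lt hA]
  refine lt_of_lt_of_le (Finset.card_lt_card ((Finset.filter_ssubset).mpr ⟨A, hA, lt_irrefl _⟩)) ?_
  simpa using hm

open Classical in
theorem card_filter_firstColex {t r m : ℕ} (hm : m ≤ t.choose r) :
    (((Finset.range t).powersetCard r).filter (· ∈ firstColex r m)).card = m := by
  have h := card_filter_card_lt (((Finset.range t).powersetCard r).map toColex.toEmbedding) m
    (by simpa using hm)
  rw [Finset.filter_map, Finset.card_map] at h
  refine Eq.trans (congrArg Finset.card (Finset.filter_congr fun A hA => ?_)) h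
  rw [Function.comp_apply, Finset.filter_map, Finset.card_map]
  exact ⟨fun hf => (ncard_colex_lt hA).symm.trans_lt hf.2,
    fun hf => ⟨(Finset.mem_powersetCard.mp hA).2, (ncard_colex_lt hA).trans_lt hf⟩⟩

theorem card_edges_colexRGraph {t r m : ℕ} (hm : m ≤ t.choose r) :
    (colexRGraph t r m).edges.card = m := by
  classical
  conv_rhs => rw [← card_filter_firstColex hm]
  refine Finset.card_bij (fun A _ => A.map Fin.valEmbedding) ?_ ?_ ?_
  · intro A hA
    have hA' : A.map Fin.valEmbedding ∈ firstColex r m := (Finset.mem_filter.mp hA).2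
    refine Finset.mem_filter.mpr ⟨Finset.mem_powersetCard.mpr ⟨fun i hi => ?_, hA'.1⟩, hA'⟩
    obtain ⟨j, -, rfl⟩ := Finset.mem_map.mp hi
    exact Finset.mem_range.mpr j.2
  · intro A _ B _ h
    exact Finset.map_injective _ h
  · intro A hA
    obtain ⟨hA, hf⟩ := Finset.mem_filter.mp hA
    have hlt : ∀ i ∈ A, i < t := fun i hi =>
      Finset.mem_range.mp ((Finset.mem_powersetCard.mp hA).1 hi)
    have hmap : (A.attachFin hlt).map Fin.valEmbedding = A := by
      ext i
      simp only [Finset.mem_map, Finset.mem_attachFin, Fin.valEmbedding_apply]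
      exact ⟨fun ⟨j, hj, hji⟩ => hji ▸ hj, fun hi => ⟨⟨i, hlt i hi⟩, hi, rfl⟩⟩
    exact ⟨A.attachFin hlt, Finset.mem_filter.mpr ⟨Finset.mem_univ _, hmap.symm ▸ hf⟩, hmap⟩

/-- An optimal weighting of the complete graph is extended by weight 0 on the last vertex; all
`r`-subsets of the other vertices are colex edges. -/
theorem lagrangian_completeRGraph_le_colexRGraph {n r m : ℕ} (hn : 0 < n)
    (hm : n.choose r ≤ m) :
    (completeRGraph n r).lagrangian ≤ (colexRGraph (n + 1) r m).lagrangian := by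
  classical
  have : Nonempty (Fin n) := ⟨⟨0, hn⟩⟩
  obtain ⟨⟨x, hx, hmax⟩, -⟩ := (completeRGraph n r).isGreatest_lagrangian
  set y : Fin (n + 1) → ℝ := Fin.snoc x 0 with hy
  have hyx : y ∘ Fin.castSuccEmb = x := by
    ext i
    simp [hy]
  have hy0 : ∀ i, 0 ≤ y i := by
    intro i
    refine Fin.lastCases ?_ (fun j => ?_) i
    · simp [hy]
    · simpa [hy] using hx.1 j
  have hmem : y ∈ stdSimplex ℝ (Fin (n + 1)) :=
    ⟨hy0, by rw [Fin.sum_univ_castSucc]; simpa [hy] using hx.2⟩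
  refine le_trans ?_ ((colexRGraph (n + 1) r m).weightPoly_le_lagrangian hmem)
  rw [← hmax, weightPoly_completeRGraph, ← hyx, ← elemSymm_map]
  refine Finset.sum_le_sum_of_subset_of_nonneg (fun e he => ?_)
    fun _ _ _ => Finset.prod_nonneg fun i _ => hy0 i
  obtain ⟨hs, hc⟩ := Finset.mem_powersetCard.mp he
  refine Finset.mem_filter.mpr ⟨Finset.mem_univ e, mem_firstColex_of_subset_range hm
    (Finset.mem_powersetCard.mpr ⟨fun i hi => ?_, by rw [Finset.card_map, hc]⟩)⟩
  obtain ⟨j, hj, rfl⟩ := Finset.mem_map.mp hi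
  obtain ⟨a, -, rfl⟩ := Finset.mem_map.mp (hs hj)
  exact Finset.mem_range.mpr a.2

/-! ### Conclusion -/

theorem RGraph.lagrangian_eq_zero_of_edges_eq_empty {V : Type*} [Fintype V] [Nonempty V] {r : ℕ}
    (G : RGraph V r) (h : G.edges = ∅) : G.lagrangian = 0 := by
  obtain ⟨⟨x, -, hx⟩, -⟩ := G.isGreatest_lagrangian
  rw [← hx, RGraph.weightPoly, h, Finset.sum_empty]

theorem RGraph.card_edges_le_choose {V : Type*} [Fintype V] {r : ℕ} (G : RGraph V r) :
    G.edges.card ≤ (Fintype.card V).choose r := by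
  rw [← Finset.card_univ, ← Finset.card_powersetCard]
  exact Finset.card_le_card fun e he =>
    Finset.mem_powersetCard.mpr ⟨Finset.subset_univ e, G.card_eq e he⟩

theorem RGraph.lagrangian_le_completeRGraph {k n : ℕ} (hk : 2 ≤ k) (hn : 0 < n) {K : ℝ}
    (hK : (k + 2) * 2 ^ k ≤ K) {V : Type*} [Fintype V] (hV : Fintype.card V = n + 1)
    (G : RGraph V (k + 2)) (hlow : n.choose (k + 2) ≤ G.edges.card)
    (hup : (G.edges.card : ℝ) ≤ n.choose (k + 2) + (n - 1).choose (k + 1)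
      - K * ((n - 1).choose k - 1)) :
    G.lagrangian ≤ (completeRGraph n (k + 2)).lagrangian := by
  classical
  have : Nonempty V := Fintype.card_pos_iff.mp (by omega)
  have hcard := G.card_edges_le_choose
  rw [hV] at hcard
  by_cases hnk : k + 1 < n
  · have hC : (1 : ℝ) ≤ (n - 1).choose k := by
      exact_mod_cast Nat.choose_pos (by omega : k ≤ n - 1)
    have hlow' : (n.choose (k + 2) : ℝ) ≤ G.edges.card := by exact_mod_cast hlow
    have hmul := mul_le_mul_of_nonneg_right hK (sub_nonneg.mpr hC)
    -- The size condition on `n` says only that the lower and upper bounds on the number of edges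
    -- are compatible.
    refine G.lagrangian_le_of_card_compl hk hnk hV (by linarith) ?_
    have hM : ((Finset.univ.powersetCard (k + 2) \ G.edges).card : ℝ)
        = (n + 1).choose (k + 2) - G.edges.card := by
      rw [Finset.card_sdiff_of_subset fun e he =>
        Finset.mem_powersetCard.mpr ⟨Finset.subset_univ e, G.card_eq e he⟩,
        Finset.card_powersetCard, Finset.card_univ, hV, Nat.cast_sub hcard]
    have hp : ((n + 1).choose (k + 2) : ℝ)
        = (n - 1).choose k + (n - 1).choose (k + 1) + n.choose (k + 2) := by
      obtain ⟨j, rfl⟩ : ∃ j, n = j + 1 := ⟨n - 1, by omega⟩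
      rw [Nat.choose_succ_succ (j + 1) (k + 1), Nat.choose_succ_succ j k]
      push_cast
      rfl
    rw [hM, hp]
    linarith
  -- For `n = k + 1` the upper bound is 0; for smaller `n` there are no `r`-sets at all.
  · have h0 : G.edges.card = 0 := by
      rcases (not_lt.mp hnk).eq_or_lt with h | h
      · subst h
        simp at hup
        rw [hup, Finset.card_empty]
      · rw [Nat.choose_eq_zero_of_lt (by omega)] at hcard
        omega
    rw [G.lagrangian_eq_zero_of_edges_eq_empty (Finset.card_eq_zero.mp h0)]
    exact lagrangian_completeRGraph_nonneg hn _

end HypergraphLagrangian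

theorem corollary1p7 (r t m : ℕ) (hr : 4 ≤ r) (ht : 2 ≤ t)
    (hlow : (t - 1).choose r ≤ m)
    (hup : (m : ℤ) ≤ ((t - 1).choose r : ℤ) + ((t - 2).choose (r - 1) : ℤ)
      - ((2 * (r : ℤ) - 6) * 2 ^ (r - 1) + 2 ^ (r - 3) + ((r : ℤ) - 4) * (2 * (r : ℤ) - 7) - 1)
        * (((t - 2).choose (r - 2) : ℤ) - 1))
    {V : Type*} [Fintype V] (hV : Fintype.card V = t)
    (G : HypergraphLagrangian.RGraph V r) (hm : G.edges.card = m) :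
    G.lagrangian ≤ (HypergraphLagrangian.completeRGraph (t - 1) r).lagrangian ∧
      (HypergraphLagrangian.colexRGraph t r m).edges.card = m ∧
      G.lagrangian ≤ (HypergraphLagrangian.colexRGraph t r m).lagrangian := by
  subst hm
  obtain ⟨n, rfl⟩ : ∃ n, t = n + 1 := ⟨t - 1, by omega⟩
  obtain ⟨l, rfl⟩ : ∃ l, r = l + 4 := ⟨r - 4, by omega⟩
  have hn : 0 < n := by omega
  have hcard := G.card_edges_le_choose
  rw [hV] at hcard
  simp only [Nat.add_sub_cancel, show n + 1 - 2 = n - 1 by omega, show l + 4 - 1 = l + 3 by omega,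
    show l + 4 - 2 = l + 2 by omega, show l + 4 - 3 = l + 1 by omega] at hlow hup ⊢
  have hmain : G.lagrangian ≤ (HypergraphLagrangian.completeRGraph n (l + 4)).lagrangian := by
    refine G.lagrangian_le_completeRGraph (k := l + 2)
      (K := (2 * ((l : ℝ) + 4) - 6) * 2 ^ (l + 3) + 2 ^ (l + 1)
        + ((l + 4 : ℝ) - 4) * (2 * ((l : ℝ) + 4) - 7) - 1) (by omega) hn ?_ hV hlow ?_
    -- The argument needs only the constant `r * 2 ^ (r - 2)`; for `r = 4` this is 16, against 17 in
    -- the hypothesis.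
    · have h1 : (1 : ℝ) ≤ 2 ^ l := one_le_pow₀ (by norm_num)
      have h2 : (0 : ℝ) ≤ l := Nat.cast_nonneg l
      push_cast
      simp only [pow_succ]
      nlinarith [mul_nonneg h2 (zero_le_one.trans h1), mul_nonneg h2 h2]
    · exact_mod_cast hup
  exact ⟨hmain, HypergraphLagrangian.card_edges_colexRGraph hcard,
    hmain.trans (HypergraphLagrangian.lagrangian_completeRGraph_le_colexRGraph hn hlow)⟩
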